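/- Let $I\subset\mathbb R$ be a nonempty open interval and let $\gamma:I\to\mathbb R^3$ be a smooth curve parametrized by arc length with curvature $\kappa_\gamma>0$, Frenet frame $(T_\gamma,N_\gamma,B_\gamma)$, torsion $\tau_\gamma$ (sign convention $B'=-\tau N$) and $\rho=\tau_\gamma/\kappa_\gamma$. A vector field $Y$ on $\mathbb R^3$ is concircular with factor $\mu$ if $dY=\mu\,\mathrm{Id}$ for a smooth function $\mu$. Suppose that $\gamma$ is a proper concircular helix with axis $Y$: $\langle N_\gamma,Y\rangle=\lambda$ is a nonzero constant along $\gamma$ and the factor $\mu$ of $Y$ is not identically zero. Suppose also that $\rho'$ and $\rho''$ vanish nowhere on $I$, so that $\gamma$ is nowhere a generalized helix ($\rho'=0$) and nowhere a rectifying curve ($\rho''=0$, $\rho'\ne0$); in particular $\gamma$ is not contained in a plane. Then $\mu$ is constant, and with $m=-\mu/\lambda\neq0$, $$\left(\frac{\rho'}{\kappa_\gamma(1+\rho^2)^{3/2}}\right)'=m\,\frac{\rho''}{\kappa_\gamma^2(1+\rho^2)^{5/2}}\quad\text{on } I .$$ The sign $\varepsilon=-\operatorname{sign}(\rho'\rho'')\in\{1,-1\}$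 is constant on $I$, and for every $n\in\mathbb R$ the following holds. Put $$\omega=-\operatorname{arccot}\rho,\qquad u=-\frac1m\left(\kappa_\gamma\frac{(1+\rho^2)^{3/2}}{\rho'}+n\right),\qquad v=u-\frac{\sin\omega}{\omega'},$$ with $\operatorname{arccot}$ taking values in $(0,\pi)$. Then $u'\neq0$ on $I$, $u$ is injective on $I$, and there is a smooth unit speed rectifying curve $\alpha:u(I)\to\mathbb R^3$ (that is, $\kappa_\alpha>0$ and the position vector $\alpha(t)$ lies in the span of $T_\alpha(t)$ and $B_\alpha(t)$ for every $t\in u(I)$) such that $$\kappa_\alpha(u(s))=-\varepsilon\,\frac{\omega'(s)}{u'(s)}\quad(s\in I),\qquad \frac{\tau_\alpha}{\kappa_\alpha}(t)=\varepsilon\,(m\,t+n)\quad(t\in u(I)),$$ and such that $\widetilde\gamma(s)=Z(u(s),v(s))$, $s\in I$, is a geodesic of the tangent surface $Z(t,w)=\alpha(t)+(w-t)\,T_\alpha(t)$, $t\in u(I)$, $w\neq t$ (a regular surface), and $\gamma$ is congruent to $\widetilde\gamma$ by an orientation-preserving rigid motion. -/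

import Mathlib

noncomputable section

open scoped ContDiff RealInnerProductSpace

namespace SpaceCurve

/-- Euclidean 3-space. -/
abbrev E3 := EuclideanSpace ℝ (Fin 3)

/-- The vector product of Euclidean 3-space. -/
def cross (a b : E3) : E3 := WithLp.toLp 2 (crossProduct a.ofLp b.ofLp)

/-! ### Frenet apparatus of unit speed curves -/

/-- The unit tangent (for a unit speed curve). -/
def tangent (γ : ℝ → E3) (s : ℝ) : E3 := deriv γ s

/-- The curvature (for a unit speed curve). -/
def curvature (γ : ℝ → E3) (s : ℝ) : ℝ := ‖deriv (tangent γ) s‖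

/-- The principal normal, `T' = κ N`. -/
def normal (γ : ℝ → E3) (s : ℝ) : E3 := (curvature γ s)⁻¹ • deriv (tangent γ) s

/-- The binormal, `B = T × N`. -/
def binormal (γ : ℝ → E3) (s : ℝ) : E3 := cross (tangent γ s) (normal γ s)

/-- The torsion, with the sign convention `B' = -τ N`. -/
def torsion (γ : ℝ → E3) (s : ℝ) : ℝ := -⟪deriv (binormal γ) s, normal γ s⟫

/-- The ratio `ρ = τ / κ`. -/
def ratio (γ : ℝ → E3) (s : ℝ) : ℝ := torsion γ s / curvature γ s

/-- `γ` is a smooth curve on the nonempty open interval `I`, parametrized by arc length and with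
positive curvature (so that its Frenet frame is defined along `I`).  Values of `γ` outside `I`
are irrelevant. -/
structure IsFrenetCurve (γ : ℝ → E3) (I : Set ℝ) : Prop where
  isOpen : IsOpen I
  ordConnected : I.OrdConnected
  nonempty : I.Nonempty
  smooth : ContDiffOn ℝ ∞ γ I
  unit_speed : ∀ s ∈ I, ‖deriv γ s‖ = 1
  curvature_pos : ∀ s ∈ I, 0 < curvature γ s

/-- A rectifying curve: its position vector always lies in its rectifying plane, the linear span
of `T` and `B`. -/
structure IsRectifyingCurve (α : ℝ → E3) (J : Set ℝ) : Prop extends IsFrenetCurve α J where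
  rectifying : ∀ t ∈ J, ∃ a b : ℝ, α t = a • tangent α t + b • binormal α t

/-! ### Concircular vector fields and concircular helices -/

/-- `Y` is a concircular vector field on Euclidean 3-space with concircular factor `μ`, that is
`∇ Y = μ I` for a smooth function `μ`. -/
structure IsConcircularField (Y : E3 → E3) (μ : E3 → ℝ) : Prop where
  smooth : ContDiff ℝ ∞ Y
  smooth_factor : ContDiff ℝ ∞ μ
  fderiv_eq : ∀ p, fderiv ℝ Y p = μ p • ContinuousLinearMap.id ℝ E3

/-- `γ` is a concircular helix on `I` with axis `Y` (of factor `μ`): `⟨N, Y⟩` is the constant `l`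
along `γ`. -/
structure IsConcircularHelix (γ : ℝ → E3) (I : Set ℝ) (Y : E3 → E3) (μ : E3 → ℝ) (l : ℝ) :
    Prop where
  curve : IsFrenetCurve γ I
  field : IsConcircularField Y μ
  inner_normal : ∀ s ∈ I, ⟪normal γ s, Y (γ s)⟫ = l

/-- A proper concircular helix: `l` and the concircular factor are nonzero.  (The factor of a
concircular field of Euclidean 3-space is constant, so nonzero somewhere means nonzero
everywhere.) -/
structure IsProperConcircularHelix (γ : ℝ → E3) (I : Set ℝ) (Y : E3 → E3) (μ : E3 → ℝ) (l : ℝ) :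
    Prop extends IsConcircularHelix γ I Y μ l where
  const_ne_zero : l ≠ 0
  factor_ne_zero : ∃ p, μ p ≠ 0

/-! ### Surfaces and geodesics -/

/-- `Z` restricted to `D` is a smooth regular (immersed) parametrized surface. -/
structure IsParametrizedSurface (Z : ℝ × ℝ → E3) (D : Set (ℝ × ℝ)) : Prop where
  isOpen : IsOpen D
  smooth : ContDiffOn ℝ ∞ Z D
  immersion : ∀ p ∈ D, Function.Injective (fderiv ℝ Z p)

/-- The curve `s ↦ Z (c s)`, `s ∈ I`, is a geodesic of the parametrized surface `Z` on `D`: its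
acceleration is normal to the surface (zero tangential component). -/
structure IsGeodesic (Z : ℝ × ℝ → E3) (D : Set (ℝ × ℝ)) (c : ℝ → ℝ × ℝ) (I : Set ℝ) : Prop where
  surface : IsParametrizedSurface Z D
  smooth : ContDiffOn ℝ ∞ c I
  mapsTo : Set.MapsTo c I D
  accel_normal : ∀ s ∈ I, ∀ w : ℝ × ℝ,
    ⟪deriv (deriv fun x => Z (c x)) s, fderiv ℝ Z (c s) w⟫ = 0

/-- The tangent surface of `α`, `Z (u, v) = α u + (v - u) T u`. -/
def tangentSurface (α : ℝ → E3) (p : ℝ × ℝ) : E3 := α p.1 + (p.2 - p.1) • tangent α p.1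

/-- The parameter domain of the tangent surface of a curve defined on `J`. -/
def tangentSurfaceDomain (J : Set ℝ) : Set (ℝ × ℝ) := {p | p.1 ∈ J ∧ p.2 ≠ p.1}

/-- The curve `δ` is obtained from `γ`, on `I`, by an orientation preserving rigid motion. -/
def IsRigidlyCongruent (γ δ : ℝ → E3) (I : Set ℝ) : Prop :=
  ∃ (A : E3 ≃ₗᵢ[ℝ] E3) (b : E3),
    LinearMap.det (A.toLinearEquiv : E3 →ₗ[ℝ] E3) = 1 ∧ ∀ s ∈ I, δ s = A (γ s) + b

/-! ### The functions built from the curvature `κ` and the ratio `ρ` of a curve -/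

/-- The inverse cotangent, with values in `(0, π)`. -/
def arccot (x : ℝ) : ℝ := Real.pi / 2 - Real.arctan x

/-- `ω = - arccot ρ`. -/
def omegaFun (ρ : ℝ → ℝ) (s : ℝ) : ℝ := -arccot (ρ s)

/-- `u = -(1/m) (κ (1 + ρ²)^(3/2) / ρ' + n)`. -/
def uFun (κ ρ : ℝ → ℝ) (m n : ℝ) (s : ℝ) : ℝ :=
  -(1 / m) * (κ s * (1 + ρ s ^ 2) ^ (3 / 2 : ℝ) / deriv ρ s + n)

/-- `v = u - sin ω / ω'`. -/
def vFun (κ ρ : ℝ → ℝ) (m n : ℝ) (s : ℝ) : ℝ :=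
  uFun κ ρ m n s - Real.sin (omegaFun ρ s) / deriv (omegaFun ρ) s

end SpaceCurve

end

open SpaceCurve

namespace SpaceCurve

open scoped ContDiff RealInnerProductSpace

/-! ### The vector product -/

/-! A concircular field of Euclidean space has the form `Y p = μ 0 • p + Y 0`, so `(μ 0)⁻¹ • Y (γ
s)` is a translate of `γ`. Differentiating `⟨N, Y⟩ = l` shows that `Y = b D + l N` along `γ`, where
`D = ρ T + B` is the Darboux direction and `b = ⟨Y, B⟩`. Two further differentiations, followed by
elimination of `b`, give the natural equation (`inner_axis_tangent`, `deriv_ratio_mul_inner`,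
`natural_equation`).

Since `D' = ρ' T`, the surface ruled by `D` along the translated curve is developable, with edge of
regression `X = Y / μ - D / ρ'`: in `X'` the `T` terms cancel and `X' = (ρ'' / ρ'²) D`
(`hasDerivAt_regressionEdge`). The natural equation makes `u` a signed arc length of `X`
(`hasDerivAt_uFun`). In this parameter `X` has tangent `D / |D|`, principal normal in the span of
`T` and `B`, and binormal `-ε N` (`frenet_of_tangent_eq`). Hence `X`, a combination of `D` and `N`,
is rectifying, and the acceleration `κ N` of the translated curve is normal to the tangent surface
of `X`. The translated curve is thus a geodesic there, and the congruence is a translation. -/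

theorem inner_eq_sum (a b : E3) : ⟪a, b⟫ = a 0 * b 0 + a 1 * b 1 + a 2 * b 2 := by
  simp [PiLp.inner_apply, Fin.sum_univ_three, mul_comm]

theorem cross_apply_zero (a b : E3) : cross a b 0 = a 1 * b 2 - a 2 * b 1 := by
  simp [cross, cross_apply]

theorem cross_apply_one (a b : E3) : cross a b 1 = a 2 * b 0 - a 0 * b 2 := by
  simp [cross, cross_apply]

theorem cross_apply_two (a b : E3) : cross a b 2 = a 0 * b 1 - a 1 * b 0 := by
  simp [cross, cross_apply]

/-- The vector product as a continuous bilinear map. -/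
noncomputable def crossL : E3 →L[ℝ] E3 →L[ℝ] E3 :=
  LinearMap.toContinuousLinearMap
    ((LinearMap.toContinuousLinearMap : (E3 →ₗ[ℝ] E3) ≃ₗ[ℝ] E3 →L[ℝ] E3).toLinearMap ∘ₗ
      LinearMap.mk₂ ℝ cross (by intros; simp [cross]) (by intros; simp [cross])
        (by intros; simp [cross]) (by intros; simp [cross]))

theorem inner_cross_left (a b : E3) : ⟪a, cross a b⟫ = 0 := by
  rw [inner_eq_sum, cross_apply_zero, cross_apply_one, cross_apply_two]; ring

theorem inner_cross_right (a b : E3) : ⟪b, cross a b⟫ = 0 := by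
  rw [inner_eq_sum, cross_apply_zero, cross_apply_one, cross_apply_two]; ring

theorem inner_cross_cross (a b : E3) :
    ⟪cross a b, cross a b⟫ = ⟪a, a⟫ * ⟪b, b⟫ - ⟪a, b⟫ ^ 2 := by
  simp only [inner_eq_sum, cross_apply_zero, cross_apply_one, cross_apply_two]; ring

theorem cross_cross_self (a b : E3) :
    cross (cross a b) a = ⟪a, a⟫ • b - ⟪a, b⟫ • a := by
  ext i
  fin_cases i <;>
    simp only [Fin.zero_eta, Fin.mk_one, Fin.reduceFinMk, PiLp.sub_apply, PiLp.smul_apply,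
      smul_eq_mul, inner_eq_sum, cross_apply_zero, cross_apply_one, cross_apply_two] <;> ring

theorem cross_add_smul (x y z w : ℝ) (a b : E3) :
    cross (x • a + y • b) (z • a + w • b) = (x * w - y * z) • cross a b := by
  ext i
  fin_cases i <;>
    simp only [Fin.zero_eta, Fin.mk_one, Fin.reduceFinMk, PiLp.add_apply, PiLp.smul_apply,
      smul_eq_mul, cross_apply_zero, cross_apply_one, cross_apply_two] <;> ring

/-- Expansion of a vector in a positively oriented orthonormal frame. -/
theorem eq_sum_inner_smul {a b : E3} (ha : ⟪a, a⟫ = 1) (hb : ⟪b, b⟫ = 1) (hab : ⟪a, b⟫ = 0)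
    (x : E3) : x = ⟪x, a⟫ • a + ⟪x, b⟫ • b + ⟪x, cross a b⟫ • cross a b := by
  have hc : ⟪cross a b, cross a b⟫ = 1 := by rw [inner_cross_cross, ha, hb, hab]; norm_num
  have h1 := inner_cross_left a b
  have h2 := inner_cross_right a b
  have ho : Orthonormal ℝ ![a, b, cross a b] := by
    rw [orthonormal_iff_ite]
    intro i j
    have hn : ∀ y : E3, ⟪y, y⟫ = 1 → ‖y‖ = 1 := fun y hy => by
      rw [norm_eq_sqrt_real_inner, hy, Real.sqrt_one]
    fin_cases i <;> fin_cases j <;>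
      simp [hn a ha, hn b hb, hab, hn _ hc, h1, h2, real_inner_comm]
  let e := basisOfOrthonormalOfCardEqFinrank ho (by simp)
  have he : ⇑e = ![a, b, cross a b] := coe_basisOfOrthonormalOfCardEqFinrank ho _
  let f := e.toOrthonormalBasis (by rw [he]; exact ho)
  have hf : ⇑f = ![a, b, cross a b] := by simp [f, he]
  have := f.sum_repr' x
  rw [Fin.sum_univ_three, hf] at this
  simp only [Matrix.cons_val_zero, Matrix.cons_val_one, Matrix.cons_val] at this
  rw [real_inner_comm x a, real_inner_comm x b, real_inner_comm x (cross a b)] at this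
  exact this.symm

/-! ### The Frenet equations -/

theorem contDiffOn_deriv {F : Type*} [NormedAddCommGroup F] [NormedSpace ℝ F] {f : ℝ → F}
    {I : Set ℝ} (hI : IsOpen I) (hf : ContDiffOn ℝ ∞ f I) : ContDiffOn ℝ ∞ (deriv f) I :=
  hf.deriv_of_isOpen hI (by simp)

theorem hasDerivAt_of_contDiffOn {F : Type*} [NormedAddCommGroup F] [NormedSpace ℝ F] {f : ℝ → F}
    {I : Set ℝ} (hI : IsOpen I) (hf : ContDiffOn ℝ ∞ f I) {s : ℝ} (hs : s ∈ I) :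
    HasDerivAt f (deriv f s) s :=
  ((hf.contDiffAt (hI.mem_nhds hs)).differentiableAt (by simp)).hasDerivAt

/-- Two functions agreeing on an open set have the same derivative there. -/
theorem HasDerivAt.eq_of_eqOn {F : Type*} [NormedAddCommGroup F] [NormedSpace ℝ F] {f g : ℝ → F}
    {f' g' : F} {I : Set ℝ} (hI : IsOpen I) {s : ℝ} (hs : s ∈ I) (hf : HasDerivAt f f' s)
    (hg : HasDerivAt g g' s) (h : Set.EqOn f g I) : f' = g' :=
  hf.unique (hg.congr_of_eventuallyEq (h.eventuallyEq_of_mem (hI.mem_nhds hs)))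

namespace IsFrenetCurve

variable {γ : ℝ → E3} {I : Set ℝ} {s : ℝ}

theorem contDiffOn_tangent (h : IsFrenetCurve γ I) : ContDiffOn ℝ ∞ (tangent γ) I :=
  contDiffOn_deriv h.isOpen h.smooth

theorem deriv_tangent_ne_zero (h : IsFrenetCurve γ I) (hs : s ∈ I) : deriv (tangent γ) s ≠ 0 :=
  norm_pos_iff.1 (h.curvature_pos s hs)

theorem contDiffOn_curvature (h : IsFrenetCurve γ I) : ContDiffOn ℝ ∞ (curvature γ) I :=
  (contDiffOn_deriv h.isOpen h.contDiffOn_tangent).norm ℝ fun _ hs => h.deriv_tangent_ne_zero hs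

theorem contDiffOn_normal (h : IsFrenetCurve γ I) : ContDiffOn ℝ ∞ (normal γ) I :=
  (h.contDiffOn_curvature.inv fun s hs => (h.curvature_pos s hs).ne').smul
    (contDiffOn_deriv h.isOpen h.contDiffOn_tangent)

theorem contDiffOn_binormal (h : IsFrenetCurve γ I) : ContDiffOn ℝ ∞ (binormal γ) I :=
  (crossL.contDiff.comp_contDiffOn h.contDiffOn_tangent).clm_apply h.contDiffOn_normal

theorem contDiffOn_torsion (h : IsFrenetCurve γ I) : ContDiffOn ℝ ∞ (torsion γ) I :=
  ((contDiffOn_deriv h.isOpen h.contDiffOn_binormal).inner ℝ h.contDiffOn_normal).neg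

theorem contDiffOn_ratio (h : IsFrenetCurve γ I) : ContDiffOn ℝ ∞ (ratio γ) I :=
  h.contDiffOn_torsion.div h.contDiffOn_curvature fun s hs => (h.curvature_pos s hs).ne'

theorem hasDerivAt (h : IsFrenetCurve γ I) (hs : s ∈ I) : HasDerivAt γ (tangent γ s) s :=
  hasDerivAt_of_contDiffOn h.isOpen h.smooth hs

theorem hasDerivAt_tangent (h : IsFrenetCurve γ I) (hs : s ∈ I) :
    HasDerivAt (tangent γ) (curvature γ s • normal γ s) s := by
  have := hasDerivAt_of_contDiffOn h.isOpen h.contDiffOn_tangent hs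
  rwa [normal, smul_inv_smul₀ (h.curvature_pos s hs).ne']

theorem inner_tangent_tangent (h : IsFrenetCurve γ I) (hs : s ∈ I) :
    ⟪tangent γ s, tangent γ s⟫ = 1 := by
  rw [real_inner_self_eq_norm_sq, tangent, h.unit_speed s hs, one_pow]

theorem inner_normal_normal (h : IsFrenetCurve γ I) (hs : s ∈ I) :
    ⟪normal γ s, normal γ s⟫ = 1 := by
  have hk := h.curvature_pos s hs
  rw [normal, real_inner_self_eq_norm_sq, norm_smul, norm_inv, Real.norm_of_nonneg hk.le,
    ← curvature, inv_mul_cancel₀ hk.ne', one_pow]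

theorem inner_tangent_normal (h : IsFrenetCurve γ I) (hs : s ∈ I) :
    ⟪tangent γ s, normal γ s⟫ = 0 := by
  have h1 := HasDerivAt.eq_of_eqOn h.isOpen hs
    ((h.hasDerivAt_tangent hs).inner ℝ (h.hasDerivAt_tangent hs)) (hasDerivAt_const s (1 : ℝ))
    fun x hx => h.inner_tangent_tangent hx
  rw [inner_smul_left, inner_smul_right, real_inner_comm] at h1
  have hk := h.curvature_pos s hs
  simp only [conj_trivial] at h1
  have : curvature γ s * ⟪tangent γ s, normal γ s⟫ = 0 := by
    rw [real_inner_comm]; linarith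
  exact (mul_eq_zero.1 this).resolve_left hk.ne'

theorem inner_tangent_binormal : ⟪tangent γ s, binormal γ s⟫ = 0 := inner_cross_left _ _

theorem inner_normal_binormal : ⟪normal γ s, binormal γ s⟫ = 0 := inner_cross_right _ _

theorem inner_binormal_binormal (h : IsFrenetCurve γ I) (hs : s ∈ I) :
    ⟪binormal γ s, binormal γ s⟫ = 1 := by
  rw [binormal, inner_cross_cross, h.inner_tangent_tangent hs, h.inner_normal_normal hs,
    h.inner_tangent_normal hs]
  norm_num

theorem cross_binormal_tangent (h : IsFrenetCurve γ I) (hs : s ∈ I) :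
    cross (binormal γ s) (tangent γ s) = normal γ s := by
  rw [binormal, cross_cross_self, h.inner_tangent_tangent hs, h.inner_tangent_normal hs]
  simp

theorem eq_sum (h : IsFrenetCurve γ I) (hs : s ∈ I) (x : E3) :
    x = ⟪x, tangent γ s⟫ • tangent γ s + ⟪x, normal γ s⟫ • normal γ s +
      ⟪x, binormal γ s⟫ • binormal γ s :=
  eq_sum_inner_smul (h.inner_tangent_tangent hs) (h.inner_normal_normal hs)
    (h.inner_tangent_normal hs) x

/-- The derivative is expanded in the frame. Differentiating `⟨B, B⟩ = 1` and `⟨B, T⟩ = 0` kills its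
`B` and `T` components, and the remaining one is `-τ` by definition. -/
theorem hasDerivAt_binormal (h : IsFrenetCurve γ I) (hs : s ∈ I) :
    HasDerivAt (binormal γ) (-torsion γ s • normal γ s) s := by
  have hB := hasDerivAt_of_contDiffOn h.isOpen h.contDiffOn_binormal hs
  have h1 := HasDerivAt.eq_of_eqOn h.isOpen hs (hB.inner ℝ hB) (hasDerivAt_const s (1 : ℝ))
    fun x hx => h.inner_binormal_binormal hx
  have h2 := HasDerivAt.eq_of_eqOn h.isOpen hs (hB.inner ℝ (h.hasDerivAt_tangent hs))
    (hasDerivAt_const s (0 : ℝ)) fun x hx => by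
      rw [real_inner_comm]; exact inner_tangent_binormal
  rw [inner_smul_right, real_inner_comm, inner_normal_binormal, mul_zero, zero_add] at h2
  rw [real_inner_comm] at h1
  have e := h.eq_sum hs (deriv (binormal γ) s)
  rw [h2, show ⟪deriv (binormal γ) s, binormal γ s⟫ = 0 by linarith, zero_smul, zero_smul,
    zero_add, add_zero] at e
  rw [torsion, neg_neg, ← e]
  exact hB

theorem hasDerivAt_normal (h : IsFrenetCurve γ I) (hs : s ∈ I) :
    HasDerivAt (normal γ) (-curvature γ s • tangent γ s + torsion γ s • binormal γ s) s := by
  have hN := hasDerivAt_of_contDiffOn h.isOpen h.contDiffOn_normal hs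
  have h1 := HasDerivAt.eq_of_eqOn h.isOpen hs (hN.inner ℝ hN) (hasDerivAt_const s (1 : ℝ))
    fun x hx => h.inner_normal_normal hx
  have h2 := HasDerivAt.eq_of_eqOn h.isOpen hs (hN.inner ℝ (h.hasDerivAt_tangent hs))
    (hasDerivAt_const s (0 : ℝ)) fun x hx => by
      rw [real_inner_comm]; exact h.inner_tangent_normal hx
  have h3 := HasDerivAt.eq_of_eqOn h.isOpen hs (hN.inner ℝ (h.hasDerivAt_binormal hs))
    (hasDerivAt_const s (0 : ℝ)) fun x hx => inner_normal_binormal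
  rw [inner_smul_right, h.inner_normal_normal hs] at h2 h3
  rw [real_inner_comm] at h1
  have e := h.eq_sum hs (deriv (normal γ) s)
  rw [show ⟪deriv (normal γ) s, tangent γ s⟫ = -curvature γ s by linarith,
    show ⟪deriv (normal γ) s, normal γ s⟫ = 0 by linarith,
    show ⟪deriv (normal γ) s, binormal γ s⟫ = torsion γ s by linarith, zero_smul, add_zero] at e
  rw [← e]
  exact hN

end IsFrenetCurve

/-! ### Concircular vector fields -/

namespace IsConcircularField

variable {Y : E3 → E3} {μ : E3 → ℝ}

theorem hasFDerivAt (h : IsConcircularField Y μ) (p : E3) :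
    HasFDerivAt Y (μ p • ContinuousLinearMap.id ℝ E3) p := by
  rw [← h.fderiv_eq]
  exact (h.smooth.differentiable (by simp) p).hasFDerivAt

/-- The factor of a concircular field of Euclidean space is locally constant. -/
theorem fderiv_factor (h : IsConcircularField Y μ) (p : E3) : fderiv ℝ μ p = 0 := by
  have hμ := (h.smooth_factor.differentiable (by simp) p).hasFDerivAt
  -- Symmetry of the second derivative reads `dμ(w) z = dμ(z) w`. Pairing it with a nonzero `z`
  -- orthogonal to `w` leaves `dμ(w) ‖z‖² = 0`.
  have hsymm := second_derivative_symmetric (f := Y) h.hasFDerivAt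
    (hμ.smul_const (ContinuousLinearMap.id ℝ E3))
  ext w
  obtain ⟨z, hz0, hz⟩ : ∃ z : E3, z ≠ 0 ∧ ⟪w, z⟫ = 0 := by
    by_cases hw : w = 0
    · exact ⟨EuclideanSpace.single 0 1, by simp, by simp [hw]⟩
    · by_contra! hc
      -- Without such a `z` the functional `⟨w, ·⟩` would be injective on a space of dimension 3.
      have hk : ∀ z : E3, z ∈ (innerₗ E3 w).ker → z = 0 := fun z hz => by
        by_contra h0
        exact hc z h0 (by simpa using hz)
      have := LinearMap.finrank_range_add_finrank_ker (innerₗ E3 w)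
      rw [(Submodule.eq_bot_iff _).2 hk] at this
      have h2 := (LinearMap.range (innerₗ E3 w)).finrank_le
      simp at this h2
      omega
  by_cases hw : w = 0
  · simp [hw]
  have h1 := congrArg (fun x => ⟪z, x⟫) (hsymm w z)
  simp only [ContinuousLinearMap.smulRight_apply, smul_apply,
    ContinuousLinearMap.id_apply, inner_smul_right, real_inner_comm w z, hz, mul_zero] at h1
  have h2 : ⟪z, z⟫ ≠ 0 := fun h0 => hz0 (inner_self_eq_zero.1 h0)
  simpa using (mul_eq_zero.1 h1).resolve_right h2

theorem factor_eq (h : IsConcircularField Y μ) (p q : E3) : μ p = μ q :=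
  is_const_of_fderiv_eq_zero (h.smooth_factor.differentiable (by simp)) h.fderiv_factor p q

theorem eq_smul_add (h : IsConcircularField Y μ) (p : E3) : Y p = μ 0 • p + Y 0 := by
  have hd : ∀ p, HasFDerivAt (fun p => Y p - μ 0 • p) (0 : E3 →L[ℝ] E3) p := fun p => by
    have := (h.hasFDerivAt p).sub ((hasFDerivAt_id (𝕜 := ℝ) p).const_smul (μ 0))
    rwa [h.factor_eq p 0, sub_self] at this
  have := is_const_of_fderiv_eq_zero (fun p => (hd p).differentiableAt) (fun p => (hd p).fderiv) p 0
  simp only [smul_zero, sub_zero] at this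
  rw [← this]; abel

theorem hasDerivAt_comp (h : IsConcircularField Y μ) {γ : ℝ → E3} {s : ℝ} {x : E3}
    (hγ : HasDerivAt γ x s) : HasDerivAt (fun s => Y (γ s)) (μ 0 • x) s := by
  have := (h.hasFDerivAt (γ s)).comp_hasDerivAt s hγ
  rwa [h.factor_eq (γ s) 0] at this

end IsConcircularField

/-! ### Change of parameter -/

section Reparametrization

open Filter Topology

variable {u : ℝ → ℝ} {I : Set ℝ} {s : ℝ}

theorem isOpen_image_of_deriv_ne_zero (hI : IsOpen I) (hu : ContDiffOn ℝ ∞ u I)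
    (hu' : ∀ s ∈ I, deriv u s ≠ 0) : IsOpen (u '' I) := by
  rw [isOpen_iff_mem_nhds]
  rintro _ ⟨s, hs, rfl⟩
  have h := (hu.contDiffAt (hI.mem_nhds hs)).hasStrictDerivAt (by simp)
  rw [← h.map_nhds_eq (hu' s hs)]
  exact image_mem_map (hI.mem_nhds hs)

theorem injOn_of_deriv_ne_zero (hI : IsOpen I) (hI' : I.OrdConnected) (hu : ContDiffOn ℝ ∞ u I)
    (hu' : ∀ s ∈ I, deriv u s ≠ 0) : Set.InjOn u I := by
  have key : ∀ a ∈ I, ∀ b ∈ I, a < b → u a ≠ u b := fun a ha b hb hab he => by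
    have hsub := hI'.out ha hb
    obtain ⟨c, hc, h0⟩ := exists_hasDerivAt_eq_zero hab (hu.continuousOn.mono hsub) he
      fun x hx => hasDerivAt_of_contDiffOn hI hu (hsub (Set.Ioo_subset_Icc_self hx))
    exact hu' c (hsub (Set.Ioo_subset_Icc_self hc)) h0
  intro a ha b hb he
  rcases lt_trichotomy a b with h | h | h
  · exact (key a ha b hb h he).elim
  · exact h
  · exact (key b hb a ha h he.symm).elim

/-- Near `u s` the smooth local inverse takes values in `I`, where injectivity forces it to agree
with `invFunOn`. -/
theorem contDiffOn_invFunOn (hI : IsOpen I) (hu : ContDiffOn ℝ ∞ u I)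
    (hu' : ∀ s ∈ I, deriv u s ≠ 0) (hinj : Set.InjOn u I) :
    ContDiffOn ℝ ∞ (Function.invFunOn u I) (u '' I) := by
  rintro _ ⟨s, hs, rfl⟩
  have hc := hu.contDiffAt (hI.mem_nhds hs)
  have hd := (hasDerivAt_of_contDiffOn hI hu hs).hasFDerivAt_equiv (hu' s hs)
  have hst := hc.hasStrictFDerivAt' hd (by simp)
  refine ((hc.to_localInverse hd (by simp)).congr_of_eventuallyEq ?_).contDiffWithinAt
  filter_upwards [hst.eventually_right_inverse,
    hst.localInverse_tendsto.eventually (hI.mem_nhds hs)] with t ht hmem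
  have h1 : u (Function.invFunOn u I t) = t := Function.invFunOn_eq ⟨_, hmem, ht⟩
  exact hinj (Function.invFunOn_mem ⟨_, hmem, ht⟩) hmem (h1.trans ht.symm)

theorem invFunOn_apply (hinj : Set.InjOn u I) (hs : s ∈ I) : Function.invFunOn u I (u s) = s :=
  hinj.leftInvOn_invFunOn hs

variable {F : Type*} [NormedAddCommGroup F] [NormedSpace ℝ F]

theorem contDiffOn_comp_invFunOn (hI : IsOpen I) (hu : ContDiffOn ℝ ∞ u I)
    (hu' : ∀ s ∈ I, deriv u s ≠ 0) (hinj : Set.InjOn u I) {f : ℝ → F} (hf : ContDiffOn ℝ ∞ f I) :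
    ContDiffOn ℝ ∞ (fun t => f (Function.invFunOn u I t)) (u '' I) :=
  hf.comp (contDiffOn_invFunOn hI hu hu' hinj) (by
    rintro _ ⟨s, hs, rfl⟩
    exact Function.invFunOn_mem ⟨s, hs, rfl⟩)

/-- The derivative of a curve in a new parameter. -/
theorem hasDerivAt_of_comp_eq (hI : IsOpen I) (hu : ContDiffOn ℝ ∞ u I)
    (hu' : ∀ s ∈ I, deriv u s ≠ 0) (hinj : Set.InjOn u I) {f g : ℝ → F} {f' : F}
    (hg : ∀ s ∈ I, g (u s) = f s) (hs : s ∈ I) (hf : HasDerivAt f f' s) :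
    HasDerivAt g ((deriv u s)⁻¹ • f') (u s) := by
  have hst := (hu.contDiffAt (hI.mem_nhds hs)).hasStrictDerivAt (n := ∞) (by simp)
  have hinv := (hst.to_local_left_inverse (hu' s hs) (g := Function.invFunOn u I)
    (by filter_upwards [hI.mem_nhds hs] with x hx using invFunOn_apply hinj hx)).hasDerivAt
  have h := HasDerivAt.scomp (u s) (h := Function.invFunOn u I) (g₁ := f) (g₁' := f')
    (by rwa [invFunOn_apply hinj hs]) hinv
  refine h.congr_of_eventuallyEq ?_
  filter_upwards [(isOpen_image_of_deriv_ne_zero hI hu hu').mem_nhds (Set.mem_image_of_mem u hs)]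
  rintro _ ⟨x, hx, rfl⟩
  rw [hg x hx, Function.comp_apply, invFunOn_apply hinj hx]

end Reparametrization

/-- A continuous function without zeros on an interval has constant sign. -/
theorem exists_sign_mul_neg {f : ℝ → ℝ} {I : Set ℝ} (hI : I.OrdConnected) (hf : ContinuousOn f I)
    (h0 : ∀ s ∈ I, f s ≠ 0) : ∃ ε : ℝ, (ε = 1 ∨ ε = -1) ∧ ∀ s ∈ I, ε * f s < 0 := by
  have hc : IsPreconnected I := hI.isPreconnected
  by_cases h : ∃ a ∈ I, f a < 0
  · obtain ⟨a, ha, hfa⟩ := h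
    refine ⟨1, Or.inl rfl, fun s hs => ?_⟩
    by_contra! hn
    obtain ⟨x, hx, hx0⟩ := hc.intermediate_value ha hs hf ⟨hfa.le, by linarith⟩
    exact h0 x hx hx0
  · push Not at h
    exact ⟨-1, Or.inr rfl, fun s hs => by
      have := lt_of_le_of_ne (h s hs) (h0 s hs).symm
      linarith⟩

/-! ### The tangent surface of a Frenet curve -/

section TangentSurface

variable {α : ℝ → E3} {J : Set ℝ}

theorem curvature_normal_of_hasDerivAt {t q : ℝ} {e : E3} (h : HasDerivAt (tangent α) (q • e) t)
    (hq : 0 < q) (he : ‖e‖ = 1) : curvature α t = q ∧ normal α t = e := by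
  have hk : curvature α t = q := by
    rw [curvature, h.deriv, norm_smul, he, mul_one, Real.norm_of_nonneg hq.le]
  exact ⟨hk, by rw [normal, hk, h.deriv, inv_smul_smul₀ hq.ne']⟩

theorem isOpen_tangentSurfaceDomain (hJ : IsOpen J) : IsOpen (tangentSurfaceDomain J) :=
  (hJ.preimage continuous_fst).inter (isOpen_ne_fun continuous_snd continuous_fst)

/-- The velocity `T` of the base point cancels the `-T` coming from the factor `p.2 - p.1`. The
tangent plane is therefore spanned by `T` and `N`, and degenerates only at `p.2 = p.1`. -/
theorem IsFrenetCurve.fderiv_tangentSurface (h : IsFrenetCurve α J) {p : ℝ × ℝ} (hp : p.1 ∈ J)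
    (w : ℝ × ℝ) : fderiv ℝ (tangentSurface α) p w =
      w.2 • tangent α p.1 + ((p.2 - p.1) * (w.1 * curvature α p.1)) • normal α p.1 := by
  have h1 := (h.hasDerivAt hp).hasFDerivAt.comp p (hasFDerivAt_fst (𝕜 := ℝ) (p := p))
  have h2 := (h.hasDerivAt_tangent hp).hasFDerivAt.comp p (hasFDerivAt_fst (𝕜 := ℝ) (p := p))
  have h3 := h1.add (((hasFDerivAt_snd (𝕜 := ℝ) (p := p)).sub hasFDerivAt_fst).smul h2)
  rw [show fderiv ℝ (tangentSurface α) p = _ from h3.fderiv]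
  simp only [add_apply, smul_apply, ContinuousLinearMap.comp_apply,
    ContinuousLinearMap.smulRight_apply, sub_apply, ContinuousLinearMap.coe_fst',
    ContinuousLinearMap.coe_snd', ContinuousLinearMap.toSpanSingleton_apply, Function.comp_apply,
    Pi.sub_apply]
  module

theorem IsFrenetCurve.isParametrizedSurface_tangentSurface (h : IsFrenetCurve α J) :
    IsParametrizedSurface (tangentSurface α) (tangentSurfaceDomain J) where
  isOpen := isOpen_tangentSurfaceDomain h.isOpen
  smooth := by
    have hm : Set.MapsTo Prod.fst (tangentSurfaceDomain J) J := fun p hp => hp.1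
    exact (h.smooth.comp contDiff_fst.contDiffOn hm).add
      ((contDiff_snd.sub contDiff_fst).contDiffOn.smul
        (h.contDiffOn_tangent.comp contDiff_fst.contDiffOn hm))
  immersion := by
    rintro p ⟨hp, hne⟩
    refine (injective_iff_map_eq_zero _).2 fun w hw => ?_
    rw [h.fderiv_tangentSurface hp] at hw
    have h1 := congrArg (fun x => ⟪tangent α p.1, x⟫) hw
    have h2 := congrArg (fun x => ⟪normal α p.1, x⟫) hw
    simp only [inner_add_right, inner_smul_right, h.inner_tangent_tangent hp,
      real_inner_comm (tangent α p.1) (normal α p.1), h.inner_tangent_normal hp,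
      h.inner_normal_normal hp, inner_zero_right, mul_one, mul_zero, add_zero, zero_add] at h1 h2
    have h3 := (h.curvature_pos _ hp).ne'
    have h4 : p.2 - p.1 ≠ 0 := sub_ne_zero.2 hne
    have h5 : w.1 = 0 := by simpa [h3, h4] using h2
    exact Prod.ext h5 h1

end TangentSurface

/-! ### Functions of the curvature and the ratio -/

section Scalar

variable {κ ρ : ℝ → ℝ} {s k' r' r'' : ℝ}

theorem sqrt_one_add_sq_pos (x : ℝ) : 0 < √(1 + x ^ 2) := Real.sqrt_pos.2 (by positivity)

theorem sq_sqrt_one_add_sq (x : ℝ) : √(1 + x ^ 2) ^ 2 = 1 + x ^ 2 := Real.sq_sqrt (by positivity)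

theorem one_add_sq_rpow_three_halves (x : ℝ) :
    (1 + x ^ 2) ^ (3 / 2 : ℝ) = √(1 + x ^ 2) ^ 3 := by
  rw [Real.rpow_div_two_eq_sqrt _ (by positivity)]
  exact_mod_cast Real.rpow_natCast _ 3

theorem one_add_sq_rpow_five_halves (x : ℝ) :
    (1 + x ^ 2) ^ (5 / 2 : ℝ) = √(1 + x ^ 2) ^ 5 := by
  rw [Real.rpow_div_two_eq_sqrt _ (by positivity)]
  exact_mod_cast Real.rpow_natCast _ 5

theorem hasDerivAt_sqrt_one_add_sq (hρ : HasDerivAt ρ r' s) :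
    HasDerivAt (fun x => √(1 + ρ x ^ 2)) (ρ s * r' / √(1 + ρ s ^ 2)) s := by
  have h : HasDerivAt (fun x => 1 + ρ x ^ 2) _ s := (hρ.pow 2).const_add 1
  refine (h.sqrt (by positivity)).congr_deriv ?_
  push_cast
  field_simp

theorem hasDerivAt_omegaFun (hρ : HasDerivAt ρ r' s) :
    HasDerivAt (omegaFun ρ) (r' / (1 + ρ s ^ 2)) s := by
  exact (hρ.arctan.const_sub (Real.pi / 2)).neg.congr_deriv (by ring)

theorem sin_omegaFun : Real.sin (omegaFun ρ s) = -(1 / √(1 + ρ s ^ 2)) := by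
  rw [omegaFun, arccot, Real.sin_neg, Real.sin_pi_div_two_sub, Real.cos_arctan]

theorem uFun_eq (m n : ℝ) :
    uFun κ ρ m n = fun x => -(1 / m) * (κ x * √(1 + ρ x ^ 2) ^ 3 / deriv ρ x + n) := by
  ext x
  rw [uFun, one_add_sq_rpow_three_halves]

theorem vFun_eq (m n : ℝ) (hρ : HasDerivAt ρ r' s) (h0 : r' ≠ 0) :
    vFun κ ρ m n s = uFun κ ρ m n s + √(1 + ρ s ^ 2) / r' := by
  rw [vFun, sin_omegaFun, (hasDerivAt_omegaFun hρ).deriv]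
  have := (sqrt_one_add_sq_pos (ρ s)).ne'
  have hc2 := sq_sqrt_one_add_sq (ρ s)
  field_simp
  linear_combination -hc2

variable {m : ℝ}

theorem hasDerivAt_natural (hκ : HasDerivAt κ k' s) (hρ : HasDerivAt ρ r' s)
    (hρ' : HasDerivAt (deriv ρ) r'' s) (hk : κ s ≠ 0)
    (he : k' * (1 + ρ s ^ 2) * r' + 3 * κ s * ρ s * r' ^ 2 - κ s * (1 + ρ s ^ 2) * r'' + m * r''
      = 0) :
    HasDerivAt (fun x => deriv ρ x / (κ x * (1 + ρ x ^ 2) ^ (3 / 2 : ℝ)))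
      (m * (r'' / (κ s ^ 2 * (1 + ρ s ^ 2) ^ (5 / 2 : ℝ)))) s := by
  simp only [one_add_sq_rpow_three_halves, one_add_sq_rpow_five_halves]
  have hc := sqrt_one_add_sq_pos (ρ s)
  have hc2 := sq_sqrt_one_add_sq (ρ s)
  have h := hρ'.div (hκ.mul ((hasDerivAt_sqrt_one_add_sq hρ).pow 3))
    (mul_ne_zero hk (pow_pos hc 3).ne')
  refine HasDerivAt.congr_deriv h ?_
  simp only [Pi.mul_apply, Pi.pow_apply, hρ.deriv]
  rw [← hc2] at he
  field_simp
  push_cast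
  linear_combination -√(1 + ρ s ^ 2) ^ 2 * he

/-- Hypothesis `he` is the natural equation cleared of denominators; it eliminates `κ'`. The value
obtained is the signed speed of the regression edge along its unit Darboux direction. -/
theorem hasDerivAt_uFun (n : ℝ) (hκ : HasDerivAt κ k' s) (hρ : HasDerivAt ρ r' s)
    (hρ' : HasDerivAt (deriv ρ) r'' s) (h0 : r' ≠ 0) (hm : m ≠ 0)
    (he : k' * (1 + ρ s ^ 2) * r' + 3 * κ s * ρ s * r' ^ 2 - κ s * (1 + ρ s ^ 2) * r'' + m * r''
      = 0) :
    HasDerivAt (uFun κ ρ m n) (√(1 + ρ s ^ 2) * r'' / r' ^ 2) s := by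
  rw [uFun_eq]
  have hc := sqrt_one_add_sq_pos (ρ s)
  have hc2 := sq_sqrt_one_add_sq (ρ s)
  have h := (((hκ.mul ((hasDerivAt_sqrt_one_add_sq hρ).pow 3)).div hρ'
    (by rwa [hρ.deriv])).add_const n).const_mul (-(1 / m))
  refine HasDerivAt.congr_deriv h ?_
  simp only [Pi.mul_apply, Pi.pow_apply, hρ.deriv]
  rw [← hc2] at he
  field_simp
  push_cast
  linear_combination -√(1 + ρ s ^ 2) ^ 2 * he

end Scalar

/-! ### The Darboux direction and the equations of a concircular helix -/

variable {γ : ℝ → E3} {I : Set ℝ} {Y : E3 → E3} {μ : E3 → ℝ} {l : ℝ} {s : ℝ}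

/-- The Darboux vector of a Frenet curve divided by its curvature, `ρ T + B`. -/
noncomputable def modifiedDarboux (γ : ℝ → E3) (s : ℝ) : E3 :=
  ratio γ s • tangent γ s + binormal γ s

/-- The curve traced by the edge of regression of the surface ruled along the Darboux vectors
of a concircular helix, translated so that the zero of the axis is at the origin. -/
noncomputable def regressionEdge (γ : ℝ → E3) (Y : E3 → E3) (a : ℝ) (s : ℝ) : E3 :=
  a⁻¹ • Y (γ s) - (deriv (ratio γ) s)⁻¹ • modifiedDarboux γ s

namespace IsFrenetCurve

theorem ratio_mul_curvature (h : IsFrenetCurve γ I) (hs : s ∈ I) :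
    ratio γ s * curvature γ s = torsion γ s :=
  div_mul_cancel₀ _ (h.curvature_pos s hs).ne'

theorem hasDerivAt_ratio (h : IsFrenetCurve γ I) (hs : s ∈ I) :
    HasDerivAt (ratio γ) (deriv (ratio γ) s) s :=
  hasDerivAt_of_contDiffOn h.isOpen h.contDiffOn_ratio hs

theorem hasDerivAt_deriv_ratio (h : IsFrenetCurve γ I) (hs : s ∈ I) :
    HasDerivAt (deriv (ratio γ)) (deriv (deriv (ratio γ)) s) s :=
  hasDerivAt_of_contDiffOn h.isOpen (contDiffOn_deriv h.isOpen h.contDiffOn_ratio) hs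

theorem hasDerivAt_curvature (h : IsFrenetCurve γ I) (hs : s ∈ I) :
    HasDerivAt (curvature γ) (deriv (curvature γ) s) s :=
  hasDerivAt_of_contDiffOn h.isOpen h.contDiffOn_curvature hs

/-- The normal components `ρ κ N` and `-τ N` cancel, so along the ruling direction only `ρ'`
survives. -/
theorem hasDerivAt_modifiedDarboux (h : IsFrenetCurve γ I) (hs : s ∈ I) :
    HasDerivAt (modifiedDarboux γ) (deriv (ratio γ) s • tangent γ s) s := by
  have := ((h.hasDerivAt_ratio hs).smul (h.hasDerivAt_tangent hs)).add (h.hasDerivAt_binormal hs)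
  refine this.congr_deriv ?_
  rw [← h.ratio_mul_curvature hs]
  module

theorem contDiffOn_modifiedDarboux (h : IsFrenetCurve γ I) :
    ContDiffOn ℝ ∞ (modifiedDarboux γ) I :=
  (h.contDiffOn_ratio.smul h.contDiffOn_tangent).add h.contDiffOn_binormal

theorem hasDerivAt_unit_modifiedDarboux (h : IsFrenetCurve γ I) (hs : s ∈ I) :
    HasDerivAt (fun x => (√(1 + ratio γ x ^ 2))⁻¹ • modifiedDarboux γ x)
      ((deriv (ratio γ) s / √(1 + ratio γ s ^ 2) ^ 3) •
        (tangent γ s - ratio γ s • binormal γ s)) s := by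
  have hc := sqrt_one_add_sq_pos (ratio γ s)
  have hc2 := sq_sqrt_one_add_sq (ratio γ s)
  have := ((hasDerivAt_sqrt_one_add_sq (h.hasDerivAt_ratio hs)).inv hc.ne').smul
    (h.hasDerivAt_modifiedDarboux hs)
  refine HasDerivAt.congr_deriv this ?_
  simp only [modifiedDarboux, Pi.inv_apply]
  match_scalars
  · field_simp
    linear_combination deriv (ratio γ) s * hc2
  · field_simp

end IsFrenetCurve

namespace IsConcircularHelix

/-- Differentiate `⟨N, Y⟩ = l`: the contribution of `Y' = μ T` is orthogonal to `N`, and `κ` divides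
out of the rest. -/
theorem inner_axis_tangent (h : IsConcircularHelix γ I Y μ l) (hs : s ∈ I) :
    ⟪Y (γ s), tangent γ s⟫ = ratio γ s * ⟪Y (γ s), binormal γ s⟫ := by
  have h1 := HasDerivAt.eq_of_eqOn h.curve.isOpen hs ((h.curve.hasDerivAt_normal hs).inner ℝ
    (h.field.hasDerivAt_comp (h.curve.hasDerivAt hs))) (hasDerivAt_const s l) h.inner_normal
  rw [real_inner_smul_right, real_inner_comm, h.curve.inner_tangent_normal hs, inner_add_left,
    real_inner_smul_left, real_inner_smul_left, real_inner_comm, real_inner_comm (Y (γ s)),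
    ← h.curve.ratio_mul_curvature hs] at h1
  apply mul_left_cancel₀ (h.curve.curvature_pos s hs).ne'
  linarith

theorem hasDerivAt_inner_binormal (h : IsConcircularHelix γ I Y μ l) (hs : s ∈ I) :
    HasDerivAt (fun x => ⟪Y (γ x), binormal γ x⟫) (-torsion γ s * l) s := by
  refine ((h.field.hasDerivAt_comp (h.curve.hasDerivAt hs)).inner ℝ
    (h.curve.hasDerivAt_binormal hs)).congr_deriv ?_
  rw [real_inner_smul_left, real_inner_smul_right, IsFrenetCurve.inner_tangent_binormal,
    real_inner_comm, h.inner_normal s hs]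
  ring

/-- This is the derivative of `⟨Y, T⟩ = ρ ⟨Y, B⟩`, with `⟨Y, B⟩' = -τ l`. -/
theorem deriv_ratio_mul_inner (h : IsConcircularHelix γ I Y μ l) (hs : s ∈ I) :
    deriv (ratio γ) s * ⟪Y (γ s), binormal γ s⟫ =
      μ 0 + curvature γ s * l * (1 + ratio γ s ^ 2) := by
  have h1 := HasDerivAt.eq_of_eqOn h.curve.isOpen hs
    ((h.field.hasDerivAt_comp (h.curve.hasDerivAt hs)).inner ℝ (h.curve.hasDerivAt_tangent hs))
    ((h.curve.hasDerivAt_ratio hs).mul (h.hasDerivAt_inner_binormal hs))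
    fun x hx => h.inner_axis_tangent hx
  rw [real_inner_smul_left, real_inner_smul_right, h.curve.inner_tangent_tangent hs,
    real_inner_comm, h.inner_normal s hs, ← h.curve.ratio_mul_curvature hs] at h1
  linear_combination -h1

/-- The natural equation of a concircular helix, cleared of denominators. -/
theorem natural_equation (h : IsConcircularHelix γ I Y μ l) (hl : l ≠ 0) (hs : s ∈ I) :
    deriv (curvature γ) s * (1 + ratio γ s ^ 2) * deriv (ratio γ) s +
      3 * curvature γ s * ratio γ s * deriv (ratio γ) s ^ 2 -
      curvature γ s * (1 + ratio γ s ^ 2) * deriv (deriv (ratio γ)) s +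
      -(μ 0 / l) * deriv (deriv (ratio γ)) s = 0 := by
  -- Differentiate `deriv_ratio_mul_inner`; the undifferentiated relation `h2` then eliminates the
  -- unknown `⟨Y, B⟩`.
  have h1 := HasDerivAt.eq_of_eqOn h.curve.isOpen hs
    ((h.curve.hasDerivAt_deriv_ratio hs).mul (h.hasDerivAt_inner_binormal hs))
    ((((h.curve.hasDerivAt_curvature hs).mul_const l).mul
      (((h.curve.hasDerivAt_ratio hs).pow 2).const_add 1)).const_add (μ 0))
    fun x hx => h.deriv_ratio_mul_inner hx
  have h2 := h.deriv_ratio_mul_inner hs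
  rw [← h.curve.ratio_mul_curvature hs] at h1
  simp only [Pi.pow_apply] at h1
  push_cast at h1
  field_simp
  linear_combination -deriv (ratio γ) s * h1 + deriv (deriv (ratio γ)) s * h2

theorem hasDerivAt_axis (h : IsConcircularHelix γ I Y μ l) (hμ : μ 0 ≠ 0) (hs : s ∈ I) :
    HasDerivAt (fun x => (μ 0)⁻¹ • Y (γ x)) (tangent γ s) s := by
  have := (h.field.hasDerivAt_comp (h.curve.hasDerivAt hs)).const_smul (μ 0)⁻¹
  rwa [inv_smul_smul₀ hμ] at this

theorem hasDerivAt_regressionEdge (h : IsConcircularHelix γ I Y μ l) (hμ : μ 0 ≠ 0)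
    (hρ : deriv (ratio γ) s ≠ 0) (hs : s ∈ I) :
    HasDerivAt (regressionEdge γ Y (μ 0))
      ((deriv (deriv (ratio γ)) s / deriv (ratio γ) s ^ 2) • modifiedDarboux γ s) s := by
  refine HasDerivAt.congr_deriv ((h.hasDerivAt_axis hμ hs).sub
    (((h.curve.hasDerivAt_deriv_ratio hs).inv hρ).smul
      (h.curve.hasDerivAt_modifiedDarboux hs))) ?_
  simp only [Pi.inv_apply]
  match_scalars
  · field_simp
    ring
  · field_simp

theorem contDiffOn_regressionEdge (h : IsConcircularHelix γ I Y μ l)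
    (hρ : ∀ s ∈ I, deriv (ratio γ) s ≠ 0) (a : ℝ) : ContDiffOn ℝ ∞ (regressionEdge γ Y a) I :=
  ((h.field.smooth.comp_contDiffOn h.curve.smooth).const_smul _).sub
    (((contDiffOn_deriv h.curve.isOpen h.curve.contDiffOn_ratio).inv hρ).smul
      h.curve.contDiffOn_modifiedDarboux)

/-- The axis has equal components along `D` and along `Y - l N`, so only the directions `D` and `N`
occur. They will be the tangent and binormal directions of the edge, which makes it rectifying. -/
theorem regressionEdge_eq (h : IsConcircularHelix γ I Y μ l) (a : ℝ) (hs : s ∈ I) :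
    regressionEdge γ Y a s =
      (a⁻¹ * ⟪Y (γ s), binormal γ s⟫ - (deriv (ratio γ) s)⁻¹) • modifiedDarboux γ s +
        (a⁻¹ * l) • normal γ s := by
  have e := h.curve.eq_sum hs (Y (γ s))
  rw [h.inner_axis_tangent hs, real_inner_comm (normal γ s) (Y (γ s)), h.inner_normal s hs] at e
  rw [regressionEdge]
  nth_rw 1 [e]
  rw [modifiedDarboux]
  module

end IsConcircularHelix

/-! ### The regression edge in a unit speed parameter -/

section RegressionEdge

theorem IsConcircularHelix.hasDerivAt_of_regressionEdge {u : ℝ → ℝ} {α : ℝ → E3}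
    (h : IsConcircularHelix γ I Y μ l) (hμ : μ 0 ≠ 0)
    (hρ1 : ∀ s ∈ I, deriv (ratio γ) s ≠ 0) (hρ2 : ∀ s ∈ I, deriv (deriv (ratio γ)) s ≠ 0)
    (hu : ContDiffOn ℝ ∞ u I)
    (hu' : ∀ s ∈ I, deriv u s =
      √(1 + ratio γ s ^ 2) * deriv (deriv (ratio γ)) s / deriv (ratio γ) s ^ 2)
    (hu0 : ∀ s ∈ I, deriv u s ≠ 0) (hinj : Set.InjOn u I)
    (hα : ∀ s ∈ I, α (u s) = regressionEdge γ Y (μ 0) s) (hs : s ∈ I) :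
    HasDerivAt α ((√(1 + ratio γ s ^ 2))⁻¹ • modifiedDarboux γ s) (u s) := by
  refine (hasDerivAt_of_comp_eq h.curve.isOpen hu hu0 hinj hα hs
    (h.hasDerivAt_regressionEdge hμ (hρ1 s hs) hs)).congr_deriv ?_
  have := hρ1 s hs
  have := hρ2 s hs
  have := (sqrt_one_add_sq_pos (ratio γ s)).ne'
  rw [smul_smul, hu' s hs]
  congr 1
  field_simp

variable {u : ℝ → ℝ} {α : ℝ → E3} {ε : ℝ}

/-- The principal normal direction, up to sign, of the regression edge. -/
theorem IsFrenetCurve.norm_edgeNormal (h : IsFrenetCurve γ I) (hε : ε = 1 ∨ ε = -1) (hs : s ∈ I) :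
    ‖(ε / √(1 + ratio γ s ^ 2)) • (ratio γ s • binormal γ s - tangent γ s)‖ = 1 := by
  have hc := sqrt_one_add_sq_pos (ratio γ s)
  have hc2 := sq_sqrt_one_add_sq (ratio γ s)
  have hε2 : ε ^ 2 = 1 := by rcases hε with rfl | rfl <;> norm_num
  rw [norm_eq_sqrt_real_inner, Real.sqrt_eq_one]
  simp only [inner_sub_left, inner_sub_right, real_inner_smul_left, real_inner_smul_right,
    h.inner_tangent_tangent hs, h.inner_binormal_binormal hs, inner_tangent_binormal,
    real_inner_comm (tangent γ s) (binormal γ s)]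
  field_simp
  linear_combination (1 + ratio γ s ^ 2) * hε2 - hc2

theorem IsFrenetCurve.norm_unit_modifiedDarboux (h : IsFrenetCurve γ I) (hs : s ∈ I) :
    ‖(√(1 + ratio γ s ^ 2))⁻¹ • modifiedDarboux γ s‖ = 1 := by
  have hc := sqrt_one_add_sq_pos (ratio γ s)
  have hc2 := sq_sqrt_one_add_sq (ratio γ s)
  rw [norm_eq_sqrt_real_inner, Real.sqrt_eq_one]
  simp only [modifiedDarboux, inner_add_left, inner_add_right, real_inner_smul_left,
    real_inner_smul_right, h.inner_tangent_tangent hs, h.inner_binormal_binormal hs,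
    inner_tangent_binormal, real_inner_comm (tangent γ s) (binormal γ s)]
  field_simp
  linear_combination - hc2

/-- Both factors lie in the plane of `B` and `T`, and `B × T = N`; the coefficient is a 2 by 2
determinant. -/
theorem IsFrenetCurve.cross_unit_modifiedDarboux_edgeNormal (h : IsFrenetCurve γ I) (hs : s ∈ I) :
    cross ((√(1 + ratio γ s ^ 2))⁻¹ • modifiedDarboux γ s)
      ((ε / √(1 + ratio γ s ^ 2)) • (ratio γ s • binormal γ s - tangent γ s)) =
      -ε • normal γ s := by
  have hc := sqrt_one_add_sq_pos (ratio γ s)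
  have hc2 := sq_sqrt_one_add_sq (ratio γ s)
  have e1 : (√(1 + ratio γ s ^ 2))⁻¹ • modifiedDarboux γ s =
      (√(1 + ratio γ s ^ 2))⁻¹ • binormal γ s +
        ((√(1 + ratio γ s ^ 2))⁻¹ * ratio γ s) • tangent γ s := by
    rw [modifiedDarboux]; module
  have e2 : (ε / √(1 + ratio γ s ^ 2)) • (ratio γ s • binormal γ s - tangent γ s) =
      (ε / √(1 + ratio γ s ^ 2) * ratio γ s) • binormal γ s +
        (-(ε / √(1 + ratio γ s ^ 2))) • tangent γ s := by module
  rw [e1, e2, cross_add_smul, h.cross_binormal_tangent hs]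
  congr 1
  field_simp
  linear_combination ε * hc2

/-- The Frenet apparatus of a curve of which the tangent is the unit modified Darboux vector of
`γ`. -/
theorem IsFrenetCurve.frenet_of_tangent_eq (h : IsFrenetCurve γ I) (hu : ContDiffOn ℝ ∞ u I)
    (hu0 : ∀ s ∈ I, deriv u s ≠ 0) (hinj : Set.InjOn u I) (hε : ε = 1 ∨ ε = -1)
    (hT : ∀ s ∈ I, tangent α (u s) = (√(1 + ratio γ s ^ 2))⁻¹ • modifiedDarboux γ s)
    (hq : ∀ s ∈ I, 0 < ε * -(deriv (ratio γ) s / (1 + ratio γ s ^ 2) / deriv u s)) (hs : s ∈ I) :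
    curvature α (u s) = ε * -(deriv (ratio γ) s / (1 + ratio γ s ^ 2) / deriv u s) ∧
      normal α (u s) =
        (ε / √(1 + ratio γ s ^ 2)) • (ratio γ s • binormal γ s - tangent γ s) ∧
      binormal α (u s) = -ε • normal γ s ∧
      torsion α (u s) = curvature γ s * √(1 + ratio γ s ^ 2) / deriv u s := by
  have hε2 : ε ^ 2 = 1 := by rcases hε with rfl | rfl <;> norm_num
  have key : ∀ s ∈ I,
      curvature α (u s) = ε * -(deriv (ratio γ) s / (1 + ratio γ s ^ 2) / deriv u s) ∧
      normal α (u s) =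
        (ε / √(1 + ratio γ s ^ 2)) • (ratio γ s • binormal γ s - tangent γ s) := by
    intro s hs
    refine curvature_normal_of_hasDerivAt ?_ (hq s hs) (h.norm_edgeNormal hε hs)
    refine (hasDerivAt_of_comp_eq h.isOpen hu hu0 hinj hT hs
      (h.hasDerivAt_unit_modifiedDarboux hs)).congr_deriv ?_
    have hc := (sqrt_one_add_sq_pos (ratio γ s)).ne'
    have := hu0 s hs
    rw [← sq_sqrt_one_add_sq (ratio γ s)]
    have hsq : √(√(1 + ratio γ s ^ 2) ^ 2) = √(1 + ratio γ s ^ 2) :=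
      Real.sqrt_sq (Real.sqrt_nonneg _)
    rw [hsq]
    match_scalars
    · field_simp
      linear_combination -deriv (ratio γ) s * hε2
    · field_simp
      linear_combination deriv (ratio γ) s * ratio γ s * hε2
  have hB : ∀ s ∈ I, binormal α (u s) = -ε • normal γ s := fun s hs => by
    rw [binormal, hT s hs, (key s hs).2, h.cross_unit_modifiedDarboux_edgeNormal hs]
  refine ⟨(key s hs).1, (key s hs).2, hB s hs, ?_⟩
  -- The sign `ε` enters through both the binormal and the normal, so it drops out of the torsion by
  -- `ε² = 1`.
  have hB' := hasDerivAt_of_comp_eq h.isOpen hu hu0 hinj hB hs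
    ((h.hasDerivAt_normal hs).const_smul (-ε))
  rw [torsion, hB'.deriv, (key s hs).2, ← h.ratio_mul_curvature hs]
  simp only [inner_add_left, inner_sub_right, real_inner_smul_left, real_inner_smul_right,
    h.inner_tangent_tangent hs, h.inner_binormal_binormal hs, inner_tangent_binormal,
    real_inner_comm (tangent γ s) (binormal γ s)]
  have hc := (sqrt_one_add_sq_pos (ratio γ s)).ne'
  have hc2 := sq_sqrt_one_add_sq (ratio γ s)
  have := hu0 s hs
  field_simp
  linear_combination curvature γ s * (1 + ratio γ s ^ 2) * hε2 - curvature γ s * hc2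

end RegressionEdge

end SpaceCurve

/-! ### The rectifying curve and the geodesic on its tangent surface -/

theorem theorem4p3 (γ : ℝ → E3) (I : Set ℝ) (Y : E3 → E3) (μ : E3 → ℝ) (l : ℝ)
    (hγ : IsProperConcircularHelix γ I Y μ l)
    (hρ1 : ∀ s ∈ I, deriv (ratio γ) s ≠ 0)
    (hρ2 : ∀ s ∈ I, deriv (deriv (ratio γ)) s ≠ 0) :
    ∃ m ε : ℝ, m ≠ 0 ∧ (∀ p, m = -(μ p / l)) ∧
      -- the natural equation satisfied by the curvature and the ratio
      (∀ s ∈ I,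
        deriv (fun x => deriv (ratio γ) x /
            (curvature γ x * (1 + ratio γ x ^ 2) ^ (3 / 2 : ℝ))) s =
          m * (deriv (deriv (ratio γ)) s /
            (curvature γ s ^ 2 * (1 + ratio γ s ^ 2) ^ (5 / 2 : ℝ)))) ∧
      -- `ε` is the opposite of the sign of the product of the first two derivatives of the ratio
      (ε = 1 ∨ ε = -1) ∧
      (∀ s ∈ I, ε * (deriv (ratio γ) s * deriv (deriv (ratio γ)) s) < 0) ∧
      ∀ n : ℝ, ∀ ω u v : ℝ → ℝ,
        ω = omegaFun (ratio γ) →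
        u = uFun (curvature γ) (ratio γ) m n →
        v = vFun (curvature γ) (ratio γ) m n →
        (∀ s ∈ I, deriv u s ≠ 0) ∧ Set.InjOn u I ∧
        ∃ α : ℝ → E3,
          IsRectifyingCurve α (u '' I) ∧
          (∀ s ∈ I, curvature α (u s) = ε * -(deriv ω s / deriv u s)) ∧
          (∀ t ∈ u '' I, torsion α t / curvature α t = ε * (m * t + n)) ∧
          IsGeodesic (tangentSurface α) (tangentSurfaceDomain (u '' I))
            (fun s => (u s, v s)) I ∧
          IsRigidlyCongruent γ (fun s => tangentSurface α (u s, v s)) I := by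
  have h := hγ.toIsConcircularHelix
  have hF := h.curve
  have hI := hF.isOpen
  have hl := hγ.const_ne_zero
  have hμ : μ 0 ≠ 0 := by
    obtain ⟨p, hp⟩ := hγ.factor_ne_zero
    rwa [h.field.factor_eq p 0] at hp
  have hm : -(μ 0 / l) ≠ 0 := neg_ne_zero.2 (div_ne_zero hμ hl)
  have hρC := hF.contDiffOn_ratio
  have hρC1 := contDiffOn_deriv hI hρC
  have hρC2 := contDiffOn_deriv hI hρC1
  obtain ⟨ε, hε, hεs⟩ := exists_sign_mul_neg hF.ordConnected
    (hρC1.continuousOn.mul hρC2.continuousOn) fun s hs => mul_ne_zero (hρ1 s hs) (hρ2 s hs)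
  refine ⟨-(μ 0 / l), ε, hm, fun p => by rw [h.field.factor_eq p 0], fun s hs => ?_, hε, hεs, ?_⟩
  · exact (hasDerivAt_natural (hF.hasDerivAt_curvature hs) (hF.hasDerivAt_ratio hs)
      (hF.hasDerivAt_deriv_ratio hs) (hF.curvature_pos s hs).ne'
      (h.natural_equation hl hs)).deriv
  have hε2 : ε ^ 2 = 1 := by rcases hε with rfl | rfl <;> norm_num
  generalize hmdef : -(μ 0 / l) = m at hm
  rintro n ω u v hω hu hv
  have hcpos := fun s => sqrt_one_add_sq_pos (ratio γ s)
  have hcC : ContDiffOn ℝ (⊤ : ℕ∞) (fun s => √(1 + ratio γ s ^ 2)) I :=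
    (contDiffOn_const.add (hρC.pow 2)).sqrt fun s _ => by positivity
  have huC : ContDiffOn ℝ (⊤ : ℕ∞) u I := by
    rw [hu, uFun_eq]
    exact contDiffOn_const.mul
      (((hF.contDiffOn_curvature.mul (hcC.pow 3)).div hρC1 hρ1).add contDiffOn_const)
  have hud : ∀ s ∈ I, HasDerivAt u
      (√(1 + ratio γ s ^ 2) * deriv (deriv (ratio γ)) s / deriv (ratio γ) s ^ 2) s :=
    fun s hs => by
      rw [hu]
      exact hasDerivAt_uFun n (hF.hasDerivAt_curvature hs) (hF.hasDerivAt_ratio hs)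
        (hF.hasDerivAt_deriv_ratio hs) (hρ1 s hs) hm (hmdef ▸ h.natural_equation hl hs)
  have hu' := fun s hs => (hud s hs).deriv
  have hu0 : ∀ s ∈ I, deriv u s ≠ 0 := fun s hs => by
    rw [hu' s hs]
    exact div_ne_zero (mul_ne_zero (hcpos s).ne' (hρ2 s hs)) (pow_ne_zero 2 (hρ1 s hs))
  have hinj := injOn_of_deriv_ne_zero hI hF.ordConnected huC hu0
  have hvu : ∀ s ∈ I, v s = u s + √(1 + ratio γ s ^ 2) / deriv (ratio γ) s := fun s hs => by
    rw [hv, hu]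
    exact vFun_eq m n (hF.hasDerivAt_ratio hs) (hρ1 s hs)
  have hus : ∀ s ∈ I, m * u s + n =
      -(curvature γ s * √(1 + ratio γ s ^ 2) ^ 3 / deriv (ratio γ) s) := fun s hs => by
    rw [hu, uFun_eq]
    field_simp
    ring
  -- The curve `α` is the edge of regression, reparametrized by `u`.
  refine ⟨hu0, hinj, fun t => regressionEdge γ Y (μ 0) (Function.invFunOn u I t), ?_⟩
  generalize hαdef : (fun t => regressionEdge γ Y (μ 0) (Function.invFunOn u I t)) = α
  have hα : ∀ s ∈ I, α (u s) = regressionEdge γ Y (μ 0) s := fun s hs => by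
    rw [← hαdef]
    simp only [invFunOn_apply hinj hs]
  have hT : ∀ s ∈ I, tangent α (u s) = (√(1 + ratio γ s ^ 2))⁻¹ • modifiedDarboux γ s :=
    fun s hs =>
      (h.hasDerivAt_of_regressionEdge hμ hρ1 hρ2 huC hu' hu0 hinj hα hs).deriv
  have hq : ∀ s ∈ I, 0 < ε * -(deriv (ratio γ) s / (1 + ratio γ s ^ 2) / deriv u s) :=
    fun s hs => by
      have h1 := hρ1 s hs
      have h2 := hρ2 s hs
      have hc := hcpos s
      -- Since `u'` has the sign of `ρ''`, this is `-ε ρ' ρ''` times a positive factor; the choice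
      -- of `ε` makes it positive.
      have h3 : ε * -(deriv (ratio γ) s / (1 + ratio γ s ^ 2) / deriv u s) =
          -(ε * (deriv (ratio γ) s * deriv (deriv (ratio γ)) s)) * (deriv (ratio γ) s ^ 2 /
            ((1 + ratio γ s ^ 2) * √(1 + ratio γ s ^ 2) * deriv (deriv (ratio γ)) s ^ 2)) := by
        rw [hu' s hs]
        have : 1 + ratio γ s ^ 2 ≠ 0 := by positivity
        field_simp
      rw [h3]
      exact mul_pos (neg_pos.2 (hεs s hs)) (by positivity)
  have hfr := fun s hs => hF.frenet_of_tangent_eq (s := s) huC hu0 hinj hε hT hq hs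
  have hαF : IsFrenetCurve α (u '' I) :=
    { isOpen := isOpen_image_of_deriv_ne_zero hI huC hu0
      ordConnected := (hF.ordConnected.isPreconnected.image u huC.continuousOn).ordConnected
      nonempty := hF.nonempty.image u
      smooth := by
        rw [← hαdef]
        exact contDiffOn_comp_invFunOn hI huC hu0 hinj (h.contDiffOn_regressionEdge hρ1 (μ 0))
      unit_speed := by
        rintro _ ⟨s, hs, rfl⟩
        change ‖tangent α (u s)‖ = 1
        rw [hT s hs, hF.norm_unit_modifiedDarboux hs]
      curvature_pos := by
        rintro _ ⟨s, hs, rfl⟩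
        rw [(hfr s hs).1]
        exact hq s hs }
  -- The displacement `v - u = √(1 + ρ²) / ρ'` along the unit Darboux vector adds back the `D / ρ'`
  -- subtracted in the edge.
  have hZ : ∀ s ∈ I, tangentSurface α (u s, v s) = (μ 0)⁻¹ • Y (γ s) := fun s hs => by
    have := (hcpos s).ne'
    have := hρ1 s hs
    simp only [tangentSurface]
    rw [hT s hs, hα s hs, hvu s hs, regressionEdge]
    match_scalars
    · ring
    · field_simp
      ring
  refine ⟨⟨hαF, ?_⟩, fun s hs => ?_, ?_, ?_, ?_⟩
  · rintro _ ⟨s, hs, rfl⟩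
    have hc := (hcpos s).ne'
    -- The coefficients come from `regressionEdge_eq` by substituting `D = √(1 + ρ²) T_α` and `N =
    -- -ε B_α`.
    refine ⟨√(1 + ratio γ s ^ 2) *
      ((μ 0)⁻¹ * inner ℝ (Y (γ s)) (binormal γ s) - (deriv (ratio γ) s)⁻¹), -ε * ((μ 0)⁻¹ * l), ?_⟩
    rw [hα s hs, h.regressionEdge_eq _ hs, hT s hs, (hfr s hs).2.2.1]
    match_scalars
    · field_simp
    · linear_combination -((μ 0)⁻¹ * l) * hε2
  · rw [hω, (hasDerivAt_omegaFun (hF.hasDerivAt_ratio hs)).deriv]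
    exact (hfr s hs).1
  · rintro _ ⟨s, hs, rfl⟩
    have hpos := (hcpos s).ne'
    have h1 := hρ1 s hs
    have h2 := hu0 s hs
    have h3 : ε ≠ 0 := by rcases hε with rfl | rfl <;> norm_num
    have h4 : 1 + ratio γ s ^ 2 ≠ 0 := by positivity
    rw [(hfr s hs).1, (hfr s hs).2.2.2, hus s hs, pow_succ (√(1 + ratio γ s ^ 2)) 2,
      sq_sqrt_one_add_sq]
    field_simp
    linear_combination curvature γ s * hε2
  · refine ⟨hαF.isParametrizedSurface_tangentSurface, huC.prodMk ?_, fun s hs => ?_, ?_⟩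
    · exact (huC.add (hcC.div hρC1 hρ1)).congr hvu
    · refine ⟨⟨s, hs, rfl⟩, ?_⟩
      change v s ≠ u s
      rw [hvu s hs, Ne, add_eq_left]
      exact div_ne_zero (hcpos s).ne' (hρ1 s hs)
    · intro s hs w
      -- The curve on the surface has velocity `T` and acceleration `κ N`, while the tangent plane
      -- is spanned by combinations of `T` and `B`.
      have hd1 : ∀ s ∈ I, deriv (fun x => tangentSurface α (u x, v x)) s = tangent γ s :=
        fun s hs => ((h.hasDerivAt_axis hμ hs).congr_of_eventuallyEq
          (Set.EqOn.eventuallyEq_of_mem hZ (hI.mem_nhds hs))).deriv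
      have hd2 := ((hF.hasDerivAt_tangent hs).congr_of_eventuallyEq
        (Set.EqOn.eventuallyEq_of_mem hd1 (hI.mem_nhds hs))).deriv
      rw [hd2, hαF.fderiv_tangentSurface ⟨s, hs, rfl⟩]
      simp only [hT s hs, (hfr s hs).2.1, modifiedDarboux, inner_add_right, inner_sub_right,
        real_inner_smul_left, real_inner_smul_right, IsFrenetCurve.inner_normal_binormal,
        real_inner_comm (tangent γ s) (normal γ s), hF.inner_tangent_normal hs]
      ring
  · refine ⟨LinearIsometryEquiv.refl ℝ E3, (μ 0)⁻¹ • Y 0, LinearMap.det_id, fun s hs => ?_⟩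
    change tangentSurface α (u s, v s) = γ s + (μ 0)⁻¹ • Y 0
    rw [hZ s hs, h.field.eq_smul_add, smul_add, inv_smul_smul₀ hμ]
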